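/- Let $d\ge 1$, let $D\subseteq\mathbb{R}^d$ be a Borel set (for instance $D=\mathbb{R}^d$), and fix one of the $d$ coordinates, called the $x$-coordinate. Let time be either continuous, $[0,\infty)$, or discrete, $\{0,1,2,\dots\}$; in the discrete case a process is extended to $[0,\infty)$ as a step function. For every $m\in\mathbb{N}$ and every initial vector $z=(z_1,\dots,z_m)\in D^m$ let $Z^{(m)}=(Z^{(m)}_1,\dots,Z^{(m)}_m)$ be a (time-homogeneous) strong Markov process with RCLL paths in which each of the $m$ points moves in $D$, started from $z$ and defined on a filtered probability space with a right-continuous and complete filtration, and let $Q_m(z)$ denote its law. For $x$-coordinates $X_1,\dots,X_m$, the rank-to-index permutation is the permutation $\gamma$ of $[m]$ for which $\gamma_i$ is the index of the $i$-th smallest of $X_1,\dots,X_m$, where ties are broken by independent uniform $[0,1]$ marks. Let $\gamma^{(m)}(t)$ be the rank-to-index permutation of the $x$-coordinates of $Z^{(m)}_1(t),\dots,Z^{(m)}_m(t)$, and let $\|\gamma^{(m)}(t)-\mathrm{Uni}\|_{\mathrm{TV}}$ be the total variation distance between its law and the uniform distribution on the permutations of $[m]$. Assume: (1) for all $m$,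 all $i\neq j$ in $[m]$ and all $z\in D^m$ with $z_i=z_j$, exchanging the coordinate processes $Z^{(m)}_i$ and $Z^{(m)}_j$ of the process started from $z$ (and keeping the others) gives a process whose law is again $Q_m(z)$; (2) there is a real random variable $\zeta^*$ such that, for all $m$, all $i\ne j$ in $[m]$ and all initial vectors $z\in D^m$, the meeting time $\overline\tau^{(m)}_{ij}=\inf\{t\ge 0: Z^{(m)}_i(t)=Z^{(m)}_j(t)\}$ is stochastically dominated by $\zeta^*$, i.e. $\mathrm{P}(\overline\tau^{(m)}_{ij}>s)\le \mathrm{P}(\zeta^*>s)$ for all $s\in\mathbb{R}$. Let $\zeta^*_1,\dots,\zeta^*_m$ be independent and distributed as $\zeta^*$. Then, for every $m$ and every initial vector $z\in D^m$, $$\|\gamma^{(m)}(t)-\mathrm{Uni}\|_{\mathrm{TV}}\le \mathrm{P}\left(\zeta^*_1+\dots+\zeta^*_m>t\right)\qquad\text{for all } t\ge 0.$$ In particular, if $\mathrm{E}(\zeta^*)<\infty$, then the mixing time for shuffling is $O(m)$: for every $\varepsilon>0$ there is a constant $C$ such that, for every $m$, the mixing time, i.e. the infimum of the times $t\ge 0$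 at which $\|\gamma^{(m)}(t)-\mathrm{Uni}\|_{\mathrm{TV}}<\varepsilon$ for all initial vectors $z\in D^m$, is at most $Cm$. -/

import Mathlib

open MeasureTheory ProbabilityTheory Filter Topology
open scoped NNReal ENNReal

universe u

noncomputable section

/-- Right continuous at every `t ≥ 0`, with a left limit at every `t > 0`. -/
def IsRCLL {E : Type*} [TopologicalSpace E] (f : ℝ≥0 → E) : Prop :=
  (∀ t, ContinuousWithinAt f (Set.Ici t) t) ∧
    ∀ t, 0 < t → ∃ l, Tendsto f (𝓝[<] t) (𝓝 l)

/-- The time set is continuous, `[0, ∞)`, or discrete, `{0, 1, 2, …}`. -/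
def IsTimeSet (T : Set ℝ≥0) : Prop :=
  T = Set.univ ∨ T = Set.range (fun n : ℕ => (n : ℝ≥0))

/-- On the filtered probability space `(Ω, ℱ, P)`, which is right-continuous and complete, `Z` is a
strong Markov process of `m` points in `D ⊆ ℝ^d`, with time set `T` and RCLL paths, which starts
from `z`; here `Q y` is the law of the process that starts from `y`, a measure on the path space
`ℝ≥0 → Fin m → D` with its product σ-algebra.

A process with discrete time set is extended to all real times as a step function. -/
structure IsStrongMarkovRCLL {d m : ℕ} {D : Set (EuclideanSpace ℝ (Fin d))} (T : Set ℝ≥0)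
    (Q : Kernel (Fin m → D) (ℝ≥0 → Fin m → D)) (z : Fin m → D)
    {Ω : Type u} [mΩ : MeasurableSpace Ω] (P : Measure Ω) (ℱ : Filtration ℝ≥0 mΩ)
    (Z : ℝ≥0 → Ω → Fin m → D) : Prop where
  isProbabilityMeasure : IsProbabilityMeasure P
  rightContinuous : ℱ.IsRightContinuous
  complete : ∀ s : Set Ω, P s = 0 → MeasurableSet[ℱ 0] s
  adapted : ∀ t, Measurable[ℱ t] (Z t)
  rcll : ∀ ω, IsRCLL (fun (t : ℝ≥0) (i : Fin m) => (Z t ω i : EuclideanSpace ℝ (Fin d)))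
  const_between : ∀ s t ω, s ≤ t → Disjoint T (Set.Ioc s t) → Z t ω = Z s ω
  start : ∀ᵐ ω ∂P, Z 0 ω = z
  law : P.map (fun ω t => Z t ω) = Q z
  /-- For a stopping time `τ` with values in `T ∪ {∞}`, the conditional law of `Z (τ + ·)` given
  `ℱ_τ` on `{τ < ∞}` is `Q (Z τ)`. -/
  strongMarkov : ∀ (τ : Ω → WithTop ℝ≥0) (hτ : IsStoppingTime ℱ τ),
    (∀ ω (t : ℝ≥0), τ ω = t → t ∈ T) →
    ∀ A : Set Ω, MeasurableSet[hτ.measurableSpace] A →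
    ∀ B : Set (ℝ≥0 → Fin m → D), MeasurableSet B →
      P (A ∩ {ω | τ ω ≠ ⊤ ∧ (fun t => Z ((τ ω).untopD 0 + t) ω) ∈ B}) =
        ∫⁻ ω in A ∩ {ω | τ ω ≠ ⊤}, Q (Z ((τ ω).untopD 0) ω) B ∂P

/-- A strong Markov `m`-point motion in `D ⊆ ℝ^d`: a kernel `Q` of path laws and, for every initial
vector `z`, a realization of the process on a filtered probability space of its own. -/
structure PointMotion {d : ℕ} (D : Set (EuclideanSpace ℝ (Fin d))) (T : Set ℝ≥0) (m : ℕ) where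
  Q : Kernel (Fin m → D) (ℝ≥0 → Fin m → D)
  Ω : (Fin m → D) → Type u
  mΩ : ∀ z, MeasurableSpace (Ω z)
  P : ∀ z, Measure (Ω z)
  ℱ : ∀ z, Filtration ℝ≥0 (mΩ z)
  Z : ∀ z, ℝ≥0 → Ω z → Fin m → D
  isStrongMarkovRCLL : ∀ z, IsStrongMarkovRCLL T Q z (P z) (ℱ z) (Z z)

attribute [instance] PointMotion.mΩ

/-- The first time `t ≥ 0` at which points `i` and `j` of a path are at the same position
(`∞` if there is none). -/
def meetingTime {E : Type*} {m : ℕ} (w : ℝ≥0 → Fin m → E) (i j : Fin m) : ℝ≥0∞ :=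
  ⨅ (t : ℝ≥0) (_ : w t i = w t j), (t : ℝ≥0∞)

/-- Stochastic domination of `τ` (with values in `[0, ∞]`) by a real random variable `ζ`. -/
def StochDominated {Ω Ω₁ : Type*} [MeasurableSpace Ω] [MeasurableSpace Ω₁]
    (P : Measure Ω) (τ : Ω → ℝ≥0∞) (P₁ : Measure Ω₁) (ζ : Ω₁ → ℝ) : Prop :=
  ∀ s : ℝ, P {ω | (s : EReal) < (τ ω : EReal)} ≤ P₁ {ω | s < ζ ω}

/-- The rank-to-index permutation `γ` of positions `x` with tie-breaking marks `u`: `γ i` is the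
index of the `i`-th smallest of the pairs `(x j, u j)` in the lexicographic order. -/
def rankToIndex {m : ℕ} (x u : Fin m → ℝ) : Equiv.Perm (Fin m) :=
  Tuple.sort (fun j => toLex (x j, u j))

/-- The law of `m` independent uniform `[0,1]` tie-breaking marks. -/
def uniformMarks (m : ℕ) : Measure (Fin m → ℝ) :=
  Measure.pi (fun _ => (volume : Measure ℝ).restrict (Set.Icc 0 1))

namespace PointMotion

variable {d m : ℕ} {D : Set (EuclideanSpace ℝ (Fin d))} {T : Set ℝ≥0}

/-- If two points start at the same position, then exchanging their whole trajectories does not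
change the law of the motion. -/
def Exchangeable (M : PointMotion.{u} D T m) : Prop :=
  ∀ (z : Fin m → D) (i j : Fin m), i ≠ j → z i = z j →
    (M.P z).map (fun ω (t : ℝ≥0) (l : Fin m) => M.Z z t ω (Equiv.swap i j l)) = M.Q z

/-- The probability that the rank-to-index permutation `γ(t)` of the `k`-th coordinates of the `m`
points, with ties broken uniformly at random, lies in `A`, for the motion started from `z`. -/
def rankProb (M : PointMotion.{u} D T m) (k : Fin d) (z : Fin m → D) (t : ℝ≥0)
    (A : Finset (Equiv.Perm (Fin m))) : ℝ :=
  ((M.P z).prod (uniformMarks m)).real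
    {p | rankToIndex (fun i => (M.Z z t p.1 i : EuclideanSpace ℝ (Fin d)) k) p.2 ∈ A}

/-- The total variation distance between the law of `γ(t)`, for the motion started from `z`, and
the uniform distribution on the permutations of `m` labels. -/
def tvUniform (M : PointMotion.{u} D T m) (k : Fin d) (z : Fin m → D) (t : ℝ≥0) : ℝ :=
  ⨆ A : Finset (Equiv.Perm (Fin m)), |M.rankProb k z t A - (A.card : ℝ) / (m.factorial : ℝ)|

/-- The mixing time for shuffling: the first time at which the total variation distance from
uniform is smaller than `ε` whatever the initial positions (`∞` if there is none). -/
def mixingTime (M : PointMotion.{u} D T m) (k : Fin d) (ε : ℝ) : ℝ≥0∞ :=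
  ⨅ (t : ℝ≥0) (_ : ∀ z, M.tvUniform k z t < ε), (t : ℝ≥0∞)

end PointMotion

end

/-!
Let `π` be a permutation of the labels. If the law of the positions at time `t` is almost invariant
under relabelling by `π`, then so is the law of `γ(t)` under multiplication by `π⁻¹`, because
permuting the points and the marks together turns `γ` into `π⁻¹ * γ` (`rankToIndex_comp`). When this
holds for all `π` with the same error `c`, averaging over `π` compares `γ(t)` with a uniform
permutation (`sum_rankProb_map_mulLeft`) and gives total variation distance at most `c`
(`Exchangeable.tvUniform_le`).

The error is bounded by coupling (`Exchangeable.transition_le_add`). Write `π` as a product of at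
most `m` transpositions. At the time `τ` when points `i` and `j` meet, exchanging them does not
change the law of the future, by the strong Markov property and exchangeability; so on `τ ≤ t` one
transposition can be removed, at the cost of waiting for `τ`. By induction the error is at most the
probability that a sum of `m` successive waiting times exceeds `t`, and each waiting time is
dominated by an independent copy of `ζ` whatever the positions at its start
(`lintegral_add_measure_lt_le_conv`).

Two points need measure theory. The meeting time is a stopping time although the paths may jump: its
sublevel events are projections of progressive sets, whence the measurable projection theorem
(`MeasurableSet.nullMeasurableSet_image_snd`), which rests on the universal measurability of
analytic sets (`MeasureTheory.AnalyticSet.nullMeasurableSet`). And the strong Markov property has to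
be applied with the random delay `t - τ`, which is reached for continuous test functions through
grid-valued delays (`PointMotion.setLIntegral_le_eq_transition`); regularity of measures then
replaces continuous functions by sets (`measure_le_add_of_forall_continuous`).

The linear mixing time follows from Markov's inequality for the sum.
-/

/-! ### Right-continuous processes, analytic sets and projections -/

/-- The first point after `t` of the grid `ℕ / (n + 1)`. -/
noncomputable def nextGridPoint (n : ℕ) (t : ℝ≥0) : ℝ≥0 :=
  (⌊((n : ℝ≥0) + 1) * t⌋₊ + 1 : ℝ≥0) / (n + 1)

theorem lt_nextGridPoint (n : ℕ) (t : ℝ≥0) : t < nextGridPoint n t := by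
  rw [nextGridPoint, lt_div_iff₀' (by positivity)]
  exact Nat.lt_floor_add_one _

theorem nextGridPoint_le (n : ℕ) (t : ℝ≥0) : nextGridPoint n t ≤ t + 1 / (n + 1) := by
  rw [nextGridPoint, div_le_iff₀' (by positivity), mul_add, mul_one_div_cancel (by positivity)]
  gcongr
  exact Nat.floor_le zero_le

theorem tendsto_nextGridPoint (t : ℝ≥0) :
    Tendsto (fun n => nextGridPoint n t) atTop (𝓝[≥] t) := by
  refine tendsto_nhdsWithin_iff.2 ⟨?_, .of_forall fun n => (lt_nextGridPoint n t).le⟩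
  refine tendsto_of_tendsto_of_tendsto_of_le_of_le tendsto_const_nhds ?_
    (fun n => (lt_nextGridPoint n t).le) fun n => nextGridPoint_le n t
  simpa using (tendsto_const_nhds (x := t)).add (tendsto_one_div_add_atTop_nhds_zero_nat (𝕜 := ℝ≥0))

theorem measurable_nextGridPoint (n : ℕ) : Measurable (nextGridPoint n) := by
  unfold nextGridPoint
  fun_prop

theorem countable_range_nextGridPoint (n : ℕ) : (Set.range (nextGridPoint n)).Countable :=
  (Set.countable_range fun k : ℕ => (k + 1 : ℝ≥0) / (n + 1)).mono <| by
    rintro _ ⟨t, rfl⟩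
    exact ⟨_, rfl⟩

/-- A right-continuous process is the pointwise limit of its values at the next point of finer and
finer grids, and each of these approximations is jointly measurable. -/
theorem measurable_uncurry_of_rightContinuous {S Ω : Type*} [TopologicalSpace S]
    [TopologicalSpace.PseudoMetrizableSpace S] [MeasurableSpace S] [BorelSpace S]
    [MeasurableSpace Ω] {X : ℝ≥0 → Ω → S} (hX : ∀ t, Measurable (X t))
    (hrc : ∀ ω t, ContinuousWithinAt (fun s => X s ω) (Set.Ici t) t) :
    Measurable (fun p : ℝ≥0 × Ω => X p.1 p.2) := by
  have hlim : Tendsto (fun n (p : ℝ≥0 × Ω) => X (nextGridPoint n p.1) p.2) atTop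
      (𝓝 fun p => X p.1 p.2) :=
    tendsto_pi_nhds.2 fun p => (hrc p.2 p.1).tendsto.comp (tendsto_nextGridPoint p.1)
  refine measurable_of_tendsto_metrizable (fun n => ?_) hlim
  have h : Measurable fun p : ℕ × Ω => X ((p.1 + 1 : ℝ≥0) / (n + 1)) p.2 :=
    measurable_from_prod_countable_right fun k => hX ((k + 1 : ℝ≥0) / (n + 1))
  have h' : Measurable fun p : ℝ≥0 × Ω => (⌊((n : ℝ≥0) + 1) * p.1⌋₊, p.2) :=
    (Nat.measurable_floor.comp (measurable_const.mul measurable_fst)).prodMk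
    measurable_snd
  have heq : (fun p : ℝ≥0 × Ω => X (nextGridPoint n p.1) p.2) =
      (fun p : ℕ × Ω => X ((p.1 + 1 : ℝ≥0) / (n + 1)) p.2) ∘
        fun p : ℝ≥0 × Ω => (⌊((n : ℝ≥0) + 1) * p.1⌋₊, p.2) := by
    funext p
    simp only [Function.comp_apply, nextGridPoint]
  rw [heq]
  exact h.comp h'

/-- Analytic sets are universally measurable. The set is the range of a continuous `f` on Baire
space; restricting the coordinates one by one to `x k ≤ N k` loses arbitrarily little outer
measure, and the image of the resulting compact box is the intersection of the closures of the
intermediate images. -/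
theorem MeasureTheory.AnalyticSet.nullMeasurableSet {α : Type*} [TopologicalSpace α] [T2Space α]
    [MeasurableSpace α] [OpensMeasurableSpace α] {s : Set α} (hs : AnalyticSet s)
    (μ : Measure α) [IsFiniteMeasure μ] : NullMeasurableSet s μ := by
  rw [AnalyticSet] at hs
  rcases hs with rfl | ⟨f, hf, rfl⟩
  · exact MeasurableSet.empty.nullMeasurableSet
  have key : ∀ c : ℝ≥0∞, c < μ (Set.range f) →
      ∃ K : Set α, MeasurableSet K ∧ K ⊆ Set.range f ∧ c ≤ μ K := by
    intro c hc
    have step : ∀ (k : ℕ) (C : Set (ℕ → ℕ)), c < μ (f '' C) →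
        ∃ n : ℕ, c < μ (f '' (C ∩ {x | x k ≤ n})) := by
      intro k C hC
      have hU : f '' C = ⋃ n : ℕ, f '' (C ∩ {x | x k ≤ n}) := by
        rw [← Set.image_iUnion, ← Set.inter_iUnion]
        congr 1
        ext x
        simp only [Set.mem_inter_iff, Set.mem_iUnion, Set.mem_ofPred_eq, iff_self_and]
        exact fun _ => ⟨x k, le_rfl⟩
      have hmono : Monotone fun n : ℕ => f '' (C ∩ {x | x k ≤ n}) := fun a b hab =>
        Set.image_mono (Set.inter_subset_inter_right _ fun x (hx : x k ≤ a) => hx.trans hab)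
      rw [hU, hmono.measure_iUnion] at hC
      exact lt_iSup_iff.1 hC
    choose! g hg using step
    -- `C k` restricts the first `k` coordinates; its image keeps outer measure above `c`.
    let C : ℕ → Set (ℕ → ℕ) := fun k =>
      Nat.rec Set.univ (fun k C => C ∩ {x | x k ≤ g k C}) k
    have hCs : ∀ k, C (k + 1) = C k ∩ {x | x k ≤ g k (C k)} := fun k => rfl
    have hCc : ∀ k, c < μ (f '' C k) := by
      intro k
      induction k with
      | zero => simpa [C, Set.image_univ] using hc
      | succ k ih => rw [hCs]; exact hg k _ ih
    set N : ℕ → ℕ := fun k => g k (C k)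
    have hCmem : ∀ k x, x ∈ C k ↔ ∀ i < k, x i ≤ N i := by
      intro k x
      induction k with
      | zero => simp [C]
      | succ k ih =>
        rw [hCs, Set.mem_inter_iff, ih, Set.mem_ofPred_eq]
        simp only [Nat.lt_succ_iff_lt_or_eq]
        constructor
        · rintro ⟨h1, h2⟩ i (hi | rfl)
          exacts [h1 i hi, h2]
        · exact fun h => ⟨fun i hi => h i (Or.inl hi), h k (Or.inr rfl)⟩
    have hCanti : Antitone C := antitone_nat_of_succ_le fun k => by
      rw [hCs]; exact Set.inter_subset_left
    let K : Set (ℕ → ℕ) := Set.Iic N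
    have hK : IsCompact K := by
      have : K = Set.pi Set.univ fun i => Set.Iic (N i) := by
        ext x; simp [K, Pi.le_def]
      rw [this]
      exact isCompact_univ_pi fun i => (Set.finite_Iic _).isCompact
    refine ⟨f '' K, (hK.image hf).isClosed.measurableSet, Set.image_subset_range _ _, ?_⟩
    have hsub : ⋂ k, closure (f '' C k) ⊆ f '' K := by
      intro y hy
      by_contra hyK
      obtain ⟨V, U, hV, hU, hKV, hyU, hVU⟩ :=
        SeparatedNhds.of_isCompact_isCompact (hK.image hf) (isCompact_singleton (x := y))
          (Set.disjoint_singleton_right.2 hyK)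
      have hyU : y ∈ U := hyU rfl
      have : ∀ k, ∃ x ∈ C k, f x ∈ U := by
        intro k
        obtain ⟨_, hz, x, hx, rfl⟩ := mem_closure_iff.1 (Set.mem_iInter.1 hy k) U hU hyU
        exact ⟨x, hx, hz⟩
      choose x hxC hxU using this
      -- Truncating `x k ∈ C k` to the box `K` does not change its first `k` coordinates, so a limit
      -- point of the truncations is a limit point of `x` itself.
      obtain ⟨a, haK, φ, hφ, hlim⟩ := hK.tendsto_subseq (x := fun k => x k ⊓ N)
        (fun k => Set.mem_Iic.2 inf_le_right)
      have hlim' : Tendsto (fun k => x (φ k)) atTop (𝓝 a) := by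
        rw [tendsto_pi_nhds] at hlim ⊢
        intro i
        refine (hlim i).congr' ?_
        filter_upwards [eventually_gt_atTop i] with k hk
        exact min_eq_left ((hCmem _ _).1 (hxC (φ k)) i (hk.trans_le (hφ.le_apply)))
      have := ((hf.tendsto a).comp hlim').eventually (hV.mem_nhds (hKV ⟨a, haK, rfl⟩))
      obtain ⟨k, hk⟩ := this.exists
      exact Set.disjoint_left.1 hVU hk (hxU _)
    refine le_trans ?_ (measure_mono hsub)
    rw [Antitone.measure_iInter (fun i j hij => closure_mono (Set.image_mono (hCanti hij)))
      (fun k => isClosed_closure.measurableSet.nullMeasurableSet) ⟨0, measure_ne_top _ _⟩]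
    exact le_iInf fun k => (hCc k).le.trans (measure_mono subset_closure)
  rcases eq_or_ne (μ (Set.range f)) 0 with h0 | h0
  · exact NullMeasurableSet.of_null h0
  obtain ⟨u, -, hu, hlim⟩ := exists_seq_strictMono_tendsto' (pos_iff_ne_zero.2 h0)
  choose K hKm hKs hKc using fun n => key (u n) (hu n).2
  have hle : μ (Set.range f) ≤ μ (⋃ n, K n) :=
    le_of_tendsto' hlim fun n => (hKc n).trans (measure_mono (Set.subset_iUnion K n))
  have hm : MeasurableSet (⋃ n, K n) := MeasurableSet.iUnion hKm
  exact hm.nullMeasurableSet.congr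
    (ae_eq_of_subset_of_measure_ge (Set.iUnion_subset hKs) hle hm.nullMeasurableSet
      (measure_ne_top _ _))

/-- A measurable set in a product depends on the second factor through countably many events only,
so the second factor can be replaced by Cantor space. -/
theorem MeasurableSet.exists_preimage_prodMap {α Ω : Type*} [MeasurableSpace α] [MeasurableSpace Ω]
    {s : Set (α × Ω)} (hs : MeasurableSet s) :
    ∃ φ : Ω → ℕ → Bool, Measurable φ ∧ ∃ s' : Set (α × (ℕ → Bool)), MeasurableSet s' ∧
      s = Prod.map id φ ⁻¹' s' := by
  rw [← generateFrom_prod] at hs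
  induction s, hs using MeasurableSpace.generateFrom_induction with
  | hC s hs _ =>
    obtain ⟨a, ha, b, hb, rfl⟩ := hs
    classical
    refine ⟨fun ω _ => decide (ω ∈ b), ?_, a ×ˢ {x | x 0 = true}, ?_, ?_⟩
    · refine measurable_pi_lambda _ fun _ => measurable_to_bool ?_
      have : (fun ω => decide (ω ∈ b)) ⁻¹' {true} = b := by ext; simp
      rw [this]
      exact hb
    · exact MeasurableSet.prod ha
        (measurableSet_eq_fun (measurable_pi_apply 0) measurable_const)
    · ext ⟨x, y⟩; simp
  | empty => exact ⟨fun _ _ => true, measurable_const, ∅, MeasurableSet.empty, rfl⟩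
  | compl s _ ih =>
    obtain ⟨φ, hφ, s', hs', rfl⟩ := ih
    exact ⟨φ, hφ, s'ᶜ, hs'.compl, rfl⟩
  | iUnion s _ ih =>
    choose φ hφ s' hs' h using ih
    refine ⟨fun ω k => φ k.unpair.1 ω k.unpair.2, ?_,
      ⋃ n, Prod.map id (fun (x : ℕ → Bool) j => x (Nat.pair n j)) ⁻¹' s' n, ?_, ?_⟩
    · exact measurable_pi_lambda _ fun k => (measurable_pi_apply _).comp (hφ _)
    · refine MeasurableSet.iUnion fun n => (hs' n).preimage ?_
      exact measurable_id.prodMap (measurable_pi_lambda _ fun j => measurable_pi_apply _)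
    · rw [Set.preimage_iUnion]
      refine Set.iUnion_congr fun n => ?_
      rw [h n, ← Set.preimage_comp]
      congr 1
      ext1 ⟨x, y⟩
      simp

/-- The measurable projection theorem. The second factor is an arbitrary measurable space. -/
theorem MeasurableSet.nullMeasurableSet_image_snd {α Ω : Type*} [MeasurableSpace α]
    [StandardBorelSpace α] [MeasurableSpace Ω] {s : Set (α × Ω)} (hs : MeasurableSet s)
    (μ : Measure Ω) [IsFiniteMeasure μ] : NullMeasurableSet (Prod.snd '' s) μ := by
  obtain ⟨φ, hφ, s', hs', rfl⟩ := hs.exists_preimage_prodMap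
  have : Prod.snd '' (Prod.map id φ ⁻¹' s') = φ ⁻¹' (Prod.snd '' s') := by
    ext ω
    simp
  rw [this]
  refine NullMeasurableSet.preimage ?_ ⟨hφ, Measure.AbsolutelyContinuous.rfl⟩
  exact (hs'.analyticSet_image measurable_snd).nullMeasurableSet _

/-! ### Meeting times are stopping times -/

/-- The event that a right-continuous adapted process has visited `C` by time `t` is observable at
time `t`. A right-continuous process may come arbitrarily close to `C` and jump away from it, so
this event need not be a countable combination of events `X s ∈ C`; it is the projection of a
progressive set, and completeness of the filtration is essential. -/
theorem measurableSet_exists_le_mem {Ω S : Type*} [mΩ : MeasurableSpace Ω] [TopologicalSpace S]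
    [TopologicalSpace.PseudoMetrizableSpace S] [MeasurableSpace S] [BorelSpace S]
    {P : Measure Ω} [IsFiniteMeasure P] {ℱ : Filtration ℝ≥0 mΩ} {X : ℝ≥0 → Ω → S}
    (hcomplete : ∀ s : Set Ω, P s = 0 → MeasurableSet[ℱ 0] s)
    (hX : ∀ t, Measurable[ℱ t] (X t))
    (hrc : ∀ ω t, ContinuousWithinAt (fun s => X s ω) (Set.Ici t) t)
    {C : Set S} (hC : MeasurableSet C) (t : ℝ≥0) :
    MeasurableSet[ℱ t] {ω | ∃ s ≤ t, X s ω ∈ C} := by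
  -- The process stopped at `t` is jointly measurable for `ℱ t`.
  have hprog : Measurable[Prod.instMeasurableSpace (m₂ := ℱ t)]
      fun p : ℝ≥0 × Ω => X (min p.1 t) p.2 := by
    refine @measurable_uncurry_of_rightContinuous S Ω _ _ _ _ (ℱ t) (fun s => X (min s t))
      (fun s => (hX _).mono (ℱ.mono (min_le_right _ _)) le_rfl) fun ω s => ?_
    have hmin : ContinuousWithinAt (fun r : ℝ≥0 => min r t) (Set.Ici s) s :=
      (continuous_id.min continuous_const).continuousWithinAt
    exact (hrc ω (min s t)).comp (f := fun r => min r t) hmin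
      fun r hr => Set.mem_Ici.2 (min_le_min_right t hr)
  have hnull := @MeasurableSet.nullMeasurableSet_image_snd ℝ≥0 Ω _ _ (ℱ t) _ (hprog hC)
    (P.trim (ℱ.le t)) _
  have himage : Prod.snd '' ((fun p : ℝ≥0 × Ω => X (min p.1 t) p.2) ⁻¹' C) =
      {ω | ∃ s ≤ t, X s ω ∈ C} := by
    ext ω
    simp only [Set.mem_image, Set.mem_preimage, Prod.exists, exists_eq_right, Set.mem_ofPred_eq]
    constructor
    · rintro ⟨s, hs⟩
      exact ⟨min s t, min_le_right _ _, hs⟩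
    · rintro ⟨s, hst, hs⟩
      exact ⟨s, by rwa [min_eq_left hst]⟩
  rw [himage] at hnull
  have hc : (P.trim (ℱ.le t)).IsComplete :=
    ⟨fun s hs => ℱ.mono (zero_le) s (hcomplete s (measure_eq_zero_of_trim_eq_zero _ hs))⟩
  exact hnull.measurable_of_complete

theorem meetingTime_le {E : Type*} {m : ℕ} {w : ℝ≥0 → Fin m → E} {i j : Fin m} {t : ℝ≥0}
    (h : w t i = w t j) : meetingTime w i j ≤ t :=
  iInf₂_le (f := fun (t : ℝ≥0) (_ : w t i = w t j) => (t : ℝ≥0∞)) t h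

section MeetingTime

variable {E : Type*} [TopologicalSpace E] [T2Space E] {m : ℕ} {w : ℝ≥0 → Fin m → E} {i j : Fin m}

/-- By right-continuity, the infimum defining a finite meeting time is attained. -/
theorem exists_meetingTime_eq (hrc : ∀ t, ContinuousWithinAt w (Set.Ici t) t)
    (h : ∃ t, w t i = w t j) : ∃ t, w t i = w t j ∧ meetingTime w i j = t := by
  have hC : IsClosed {y : Fin m → E | y i = y j} :=
    isClosed_eq (continuous_apply i) (continuous_apply j)
  set S : Set ℝ≥0 := {s | w s i = w s j}
  have hcl := csInf_mem_closure (s := S) h (OrderBot.bddBelow _)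
  have hsub : S ⊆ Set.Ici (sInf S) := fun s hs => csInf_le (OrderBot.bddBelow _) hs
  have hmem := ((hrc (sInf S)).mono hsub).mem_closure_image hcl
  have hmeet : w (sInf S) i = w (sInf S) j := by
    refine hC.closure_subset_iff.2 ?_ hmem
    rintro _ ⟨s, hs, rfl⟩
    exact hs
  refine ⟨sInf S, hmeet, le_antisymm (meetingTime_le hmeet) (le_iInf₂ fun s hs => ?_)⟩
  exact_mod_cast hsub hs

theorem meetingTime_le_iff (hrc : ∀ t, ContinuousWithinAt w (Set.Ici t) t) {t : ℝ≥0} :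
    meetingTime w i j ≤ t ↔ ∃ s ≤ t, w s i = w s j := by
  constructor
  · intro h
    have hex : ∃ s, w s i = w s j := by
      by_contra hne
      push Not at hne
      simp [meetingTime, hne] at h
    obtain ⟨s, hs, hms⟩ := exists_meetingTime_eq hrc hex
    exact ⟨s, by rw [hms] at h; exact_mod_cast h, hs⟩
  · rintro ⟨s, hst, hs⟩
    exact (meetingTime_le hs).trans (by exact_mod_cast hst)

theorem apply_eq_of_meetingTime_eq (hrc : ∀ t, ContinuousWithinAt w (Set.Ici t) t) {t : ℝ≥0}
    (h : meetingTime w i j = t) : w t i = w t j := by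
  obtain ⟨s, -, hs⟩ := (meetingTime_le_iff hrc).1 h.le
  obtain ⟨r, hr, hmr⟩ := exists_meetingTime_eq hrc ⟨s, hs⟩
  rw [h] at hmr
  have : t = r := by exact_mod_cast hmr
  rwa [this]

end MeetingTime

namespace IsStrongMarkovRCLL

variable {d m : ℕ} {D : Set (EuclideanSpace ℝ (Fin d))} {T : Set ℝ≥0}
  {Q : Kernel (Fin m → D) (ℝ≥0 → Fin m → D)} {z : Fin m → D} {Ω : Type u} [mΩ : MeasurableSpace Ω]
  {P : Measure Ω} {ℱ : Filtration ℝ≥0 mΩ} {Z : ℝ≥0 → Ω → Fin m → D}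

theorem continuousWithinAt (h : IsStrongMarkovRCLL T Q z P ℱ Z) (ω : Ω) (t : ℝ≥0) :
    ContinuousWithinAt (fun s => Z s ω) (Set.Ici t) t := by
  have h1 := (h.rcll ω).1 t
  refine tendsto_pi_nhds.2 fun i => tendsto_subtype_rng.2 ?_
  exact tendsto_pi_nhds.1 h1 i

theorem measurable (h : IsStrongMarkovRCLL T Q z P ℱ Z) (t : ℝ≥0) : Measurable (Z t) :=
  (h.adapted t).mono (ℱ.le t) le_rfl

theorem measurable_uncurry (h : IsStrongMarkovRCLL T Q z P ℱ Z) :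
    Measurable fun p : ℝ≥0 × Ω => Z p.1 p.2 :=
  measurable_uncurry_of_rightContinuous h.measurable h.continuousWithinAt

theorem measurableSet_meetingTime_le (h : IsStrongMarkovRCLL T Q z P ℱ Z) (i j : Fin m)
    (t : ℝ≥0) : MeasurableSet[ℱ t] {ω | meetingTime (fun s => Z s ω) i j ≤ t} := by
  have := h.isProbabilityMeasure
  have hC : MeasurableSet {y : Fin m → D | y i = y j} :=
    measurableSet_eq_fun (measurable_pi_apply i) (measurable_pi_apply j)
  convert measurableSet_exists_le_mem h.complete h.adapted h.continuousWithinAt hC t using 1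
  ext ω
  exact meetingTime_le_iff (h.continuousWithinAt ω)

/-- The meeting time is read as a `WithTop ℝ≥0`-valued function, the type that `ℝ≥0∞` unfolds to. -/
theorem isStoppingTime_meetingTime (h : IsStrongMarkovRCLL T Q z P ℱ Z) (i j : Fin m) :
    IsStoppingTime ℱ fun ω => (meetingTime (fun s => Z s ω) i j : WithTop ℝ≥0) :=
  fun t => h.measurableSet_meetingTime_le i j t

theorem measurable_meetingTime (h : IsStrongMarkovRCLL T Q z P ℱ Z) (i j : Fin m) :
    Measurable fun ω => meetingTime (fun s => Z s ω) i j := by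
  refine measurable_of_Iic fun a => ?_
  induction a with
  | top => simp
  | coe t => exact ℱ.le t _ (h.measurableSet_meetingTime_le i j t)

/-- In discrete time, a step function can have its first meeting only at the start of a step. -/
theorem mem_of_meetingTime_eq (hT : IsTimeSet T) (h : IsStrongMarkovRCLL T Q z P ℱ Z)
    (i j : Fin m) (ω : Ω) (t : ℝ≥0) (ht : meetingTime (fun s => Z s ω) i j = t) : t ∈ T := by
  rcases hT with rfl | rfl
  · trivial
  have hle : (⌊t⌋₊ : ℝ≥0) ≤ t := Nat.floor_le zero_le
  have hconst : Z t ω = Z ⌊t⌋₊ ω := by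
    refine h.const_between _ _ ω hle (Set.disjoint_left.2 ?_)
    rintro _ ⟨n, rfl⟩ ⟨h1, h2⟩
    exact absurd (Nat.le_floor h2) (not_le.2 (Nat.cast_lt.1 h1))
  have hmeet := apply_eq_of_meetingTime_eq (h.continuousWithinAt ω) ht
  simp only [hconst] at hmeet
  have hge : (t : ℝ≥0∞) ≤ (⌊t⌋₊ : ℝ≥0) := by
    rw [← ht]
    exact meetingTime_le hmeet
  exact ⟨⌊t⌋₊, le_antisymm hle (by exact_mod_cast hge)⟩

/-- The strong Markov property for a function of the position a fixed time `s` after `τ`. -/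
theorem setLIntegral_add (h : IsStrongMarkovRCLL T Q z P ℱ Z) {τ : Ω → WithTop ℝ≥0}
    (hτ : IsStoppingTime ℱ τ) (hτT : ∀ ω (t : ℝ≥0), τ ω = t → t ∈ T) {A : Set Ω}
    (hA : MeasurableSet[hτ.measurableSpace] A) (hAτ : ∀ ω ∈ A, τ ω ≠ ⊤) (s : ℝ≥0)
    {f : (Fin m → D) → ℝ≥0∞} (hf : Measurable f) :
    ∫⁻ ω in A, f (Z ((τ ω).untopD 0 + s) ω) ∂P =
      ∫⁻ ω in A, ∫⁻ w, f (w s) ∂Q (Z ((τ ω).untopD 0) ω) ∂P := by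
  have hA' : MeasurableSet A := hτ.measurableSpace_le _ hA
  have hτm : Measurable fun ω => (τ ω).untopD 0 := hτ.measurable'.untopD 0
  have hZ : ∀ r, Measurable fun ω => Z ((τ ω).untopD 0 + r) ω := fun r =>
    h.measurable_uncurry.comp ((hτm.add_const r).prodMk measurable_id)
  have hZ0 : Measurable fun ω => Z ((τ ω).untopD 0) ω :=
    h.measurable_uncurry.comp (hτm.prodMk measurable_id)
  have heval : Measurable fun w : ℝ≥0 → Fin m → D => w s := measurable_pi_apply s
  have hAeq : A ∩ {ω | τ ω ≠ ⊤} = A := Set.inter_eq_left.2 hAτ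
  have hker : Measurable fun ω => (Q.map fun w => w s) (Z ((τ ω).untopD 0) ω) :=
    (Kernel.measurable _).comp hZ0
  have hmeas : (P.restrict A).map (fun ω => Z ((τ ω).untopD 0 + s) ω) =
      (P.restrict A).bind fun ω => (Q.map fun w => w s) (Z ((τ ω).untopD 0) ω) := by
    ext C hC
    rw [Measure.map_apply (hZ s) hC, Measure.restrict_apply ((hZ s) hC),
      Measure.bind_apply hC hker.aemeasurable]
    have := h.strongMarkov τ hτ hτT A hA ((fun w => w s) ⁻¹' C) (heval hC)
    rw [hAeq] at this
    calc _ = P (A ∩ {ω | τ ω ≠ ⊤ ∧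
          (fun t => Z ((τ ω).untopD 0 + t) ω) ∈ (fun w : ℝ≥0 → Fin m → D => w s) ⁻¹' C}) := by
          congr 1
          ext ω
          constructor
          · exact fun hω => ⟨hω.2, hAτ ω hω.2, hω.1⟩
          · exact fun hω => ⟨hω.2.2, hω.1⟩
      _ = _ := by
          rw [this]
          refine lintegral_congr fun ω => ?_
          rw [Kernel.map_apply' _ heval _ hC]
  calc _ = ∫⁻ y, f y ∂(P.restrict A).map (fun ω => Z ((τ ω).untopD 0 + s) ω) :=
        (lintegral_map hf (hZ s)).symm
    _ = _ := by
        rw [hmeas, Measure.lintegral_bind hker.aemeasurable hf.aemeasurable]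
        refine lintegral_congr fun ω => ?_
        rw [Kernel.map_apply _ heval, lintegral_map hf heval]

end IsStrongMarkovRCLL

/-! ### Transition operators and the strong Markov property at a fixed time -/

namespace PointMotion

variable {d m : ℕ} {D : Set (EuclideanSpace ℝ (Fin d))} {T : Set ℝ≥0}

/-- The transition operator: the expectation of `f` at the positions at time `t` of the motion
started from `z`. -/
noncomputable def transition (M : PointMotion.{u} D T m) (f : (Fin m → D) → ℝ≥0∞) (t : ℝ≥0)
    (z : Fin m → D) : ℝ≥0∞ :=
  ∫⁻ ω, f (M.Z z t ω) ∂M.P z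

instance (M : PointMotion.{u} D T m) (z : Fin m → D) : IsProbabilityMeasure (M.P z) :=
  (M.isStrongMarkovRCLL z).isProbabilityMeasure

variable (M : PointMotion.{u} D T m) {f : (Fin m → D) → ℝ≥0∞}

theorem measurable_path (z : Fin m → D) : Measurable fun ω t => M.Z z t ω :=
  measurable_pi_lambda _ (M.isStrongMarkovRCLL z).measurable

theorem lintegral_Q (hf : Measurable f) (t : ℝ≥0) (z : Fin m → D) :
    ∫⁻ w, f (w t) ∂M.Q z = M.transition f t z := by
  have hft : Measurable fun w : ℝ≥0 → Fin m → D => f (w t) := hf.comp (measurable_pi_apply t)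
  rw [← (M.isStrongMarkovRCLL z).law, lintegral_map hft (M.measurable_path z), transition]

theorem measurable_transition (hf : Measurable f) (t : ℝ≥0) : Measurable (M.transition f t) := by
  simp_rw [← funext (M.lintegral_Q hf t)]
  exact (hf.comp (measurable_pi_apply t)).lintegral_kernel

theorem transition_le_one (hf1 : ∀ y, f y ≤ 1) (t : ℝ≥0) (z : Fin m → D) :
    M.transition f t z ≤ 1 :=
  (lintegral_mono fun _ => hf1 _).trans (by simp)

theorem continuousWithinAt_transition (hf : Continuous f) (hf1 : ∀ y, f y ≤ 1) (z : Fin m → D)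
    (t : ℝ≥0) : ContinuousWithinAt (fun s => M.transition f s z) (Set.Ici t) t := by
  refine tendsto_lintegral_filter_of_dominated_convergence (fun _ => 1)
    (.of_forall fun s => hf.measurable.comp ((M.isStrongMarkovRCLL z).measurable s))
    (.of_forall fun s => .of_forall fun ω => hf1 _) (by simp) (.of_forall fun ω => ?_)
  exact (hf.tendsto _).comp ((M.isStrongMarkovRCLL z).continuousWithinAt ω t)

theorem measurable_uncurry_transition (hf : Continuous f) (hf1 : ∀ y, f y ≤ 1) :
    Measurable fun p : ℝ≥0 × (Fin m → D) => M.transition f p.1 p.2 :=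
  measurable_uncurry_of_rightContinuous (M.measurable_transition hf.measurable)
    (M.continuousWithinAt_transition hf hf1)

/-- The strong Markov property at a fixed time `t`: on `{τ ≤ t}`, the positions at time `t` are
distributed by the transition operator over the remaining random time `t - τ`, applied at the
positions at time `τ`. The assumed strong Markov property concerns deterministic delays after `τ`,
and evaluation of a path at a random time is not measurable on the path space, so the delay is
approximated from the right by grid-valued ones; continuity of `f` gives the limit. -/
theorem setLIntegral_le_eq_transition (z : Fin m → D) {τ : M.Ω z → WithTop ℝ≥0}
    (hτ : IsStoppingTime (M.ℱ z) τ) (hτT : ∀ ω (t : ℝ≥0), τ ω = t → t ∈ T) (t : ℝ≥0)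
    (hf : Continuous f) (hf1 : ∀ y, f y ≤ 1) :
    ∫⁻ ω in {ω | τ ω ≤ t}, f (M.Z z t ω) ∂M.P z =
      ∫⁻ ω in {ω | τ ω ≤ t},
        M.transition f (t - (τ ω).untopD 0) (M.Z z ((τ ω).untopD 0) ω) ∂M.P z := by
  have h := M.isStrongMarkovRCLL z
  have hσ : Measurable[hτ.measurableSpace] fun ω => (τ ω).untopD 0 := hτ.measurable.untopD 0
  have hσ' : Measurable fun ω => (τ ω).untopD 0 := hσ.mono hτ.measurableSpace_le le_rfl
  have hle : MeasurableSet[hτ.measurableSpace] {ω | τ ω ≤ t} := hτ.measurableSet_le' t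
  have hle' : MeasurableSet {ω | τ ω ≤ t} := hτ.measurableSpace_le _ hle
  let r : ℕ → M.Ω z → ℝ≥0 := fun n ω => nextGridPoint n (t - (τ ω).untopD 0)
  have hr : ∀ n, Measurable[hτ.measurableSpace] (r n) := fun n =>
    (measurable_nextGridPoint n).comp (hσ.const_sub t)
  have hr' : ∀ n, Measurable (r n) := fun n => (hr n).mono hτ.measurableSpace_le le_rfl
  have hZ0 : Measurable fun ω => M.Z z ((τ ω).untopD 0) ω :=
    h.measurable_uncurry.comp (hσ'.prodMk measurable_id)
  -- On each of the countably many events where the waiting time is a given grid point, the strong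
  -- Markov property applies with a deterministic delay.
  have hgrid : ∀ n, ∫⁻ ω in {ω | τ ω ≤ t}, f (M.Z z ((τ ω).untopD 0 + r n ω) ω) ∂M.P z =
      ∫⁻ ω in {ω | τ ω ≤ t}, M.transition f (r n ω) (M.Z z ((τ ω).untopD 0) ω) ∂M.P z := by
    intro n
    have : Countable (Set.range (nextGridPoint n)) := (countable_range_nextGridPoint n).to_subtype
    let A : Set.range (nextGridPoint n) → Set (M.Ω z) := fun c => {ω | τ ω ≤ t} ∩ {ω | r n ω = c}
    have hA : ∀ c, MeasurableSet[hτ.measurableSpace] (A c) := fun c =>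
      hle.inter (hr n (measurableSet_singleton (c : ℝ≥0)))
    have hA' : ∀ c, MeasurableSet (A c) := fun c => hτ.measurableSpace_le _ (hA c)
    have hdisj : Pairwise (Function.onFun Disjoint A) := fun c c' hcc =>
      Set.disjoint_left.2 fun ω h1 h2 => hcc (Subtype.ext (h1.2.symm.trans h2.2))
    have hU : {ω | τ ω ≤ t} = ⋃ c, A c := by
      ext ω
      simp only [Set.mem_iUnion]
      exact ⟨fun hω => ⟨⟨r n ω, Set.mem_range_self _⟩, hω, rfl⟩, fun ⟨c, hc⟩ => hc.1⟩
    rw [hU, lintegral_iUnion hA' hdisj, lintegral_iUnion hA' hdisj]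
    refine tsum_congr fun c => ?_
    have hmarkov := h.setLIntegral_add hτ hτT (hA c)
      (fun ω hω => (hω.1.trans_lt (WithTop.coe_lt_top t)).ne) (c : ℝ≥0) hf.measurable
    calc _ = ∫⁻ ω in A c, f (M.Z z ((τ ω).untopD 0 + c) ω) ∂M.P z :=
          setLIntegral_congr_fun (hA' c) fun ω hω => by
            have : r n ω = c := hω.2
            simp only [this]
      _ = _ := hmarkov
      _ = _ := setLIntegral_congr_fun (hA' c) fun ω hω => by
            have : r n ω = c := hω.2
            simp only [this, M.lintegral_Q hf.measurable]
  have hsub : ∀ ω ∈ {ω | τ ω ≤ t}, (τ ω).untopD 0 + (t - (τ ω).untopD 0) = t := by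
    intro ω hω
    refine add_tsub_cancel_of_le ?_
    obtain ⟨s, hs⟩ := WithTop.ne_top_iff_exists.1
      (lt_of_le_of_lt (show τ ω ≤ t from hω) (WithTop.coe_lt_top t)).ne
    have hω' : τ ω ≤ t := hω
    rw [← hs] at hω' ⊢
    rw [WithTop.untopD_coe]
    exact WithTop.coe_le_coe.1 hω'
  have hL : Tendsto
      (fun n => ∫⁻ ω in {ω | τ ω ≤ t}, f (M.Z z ((τ ω).untopD 0 + r n ω) ω) ∂M.P z) atTop
      (𝓝 (∫⁻ ω in {ω | τ ω ≤ t}, f (M.Z z t ω) ∂M.P z)) := by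
    refine tendsto_lintegral_of_dominated_convergence (fun _ => 1)
      (fun n => hf.measurable.comp
        (h.measurable_uncurry.comp ((hσ'.add (hr' n)).prodMk measurable_id)))
      (fun n => .of_forall fun ω => hf1 _) (by simp) ?_
    refine (ae_restrict_iff' hle').2 (.of_forall fun ω hω => ?_)
    refine (hf.tendsto _).comp ((h.continuousWithinAt ω t).tendsto.comp ?_)
    have h1 := (tendsto_nextGridPoint (t - (τ ω).untopD 0))
    refine tendsto_nhdsWithin_iff.2 ⟨?_, .of_forall fun n => Set.mem_Ici.2 ?_⟩
    · have h2 := (tendsto_nhdsWithin_iff.1 h1).1.const_add ((τ ω).untopD 0)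
      rwa [hsub ω hω] at h2
    · calc t = (τ ω).untopD 0 + (t - (τ ω).untopD 0) := (hsub ω hω).symm
        _ ≤ _ := by gcongr; exact (lt_nextGridPoint n _).le
  have hR : Tendsto
      (fun n => ∫⁻ ω in {ω | τ ω ≤ t}, M.transition f (r n ω) (M.Z z ((τ ω).untopD 0) ω) ∂M.P z)
      atTop (𝓝 (∫⁻ ω in {ω | τ ω ≤ t},
        M.transition f (t - (τ ω).untopD 0) (M.Z z ((τ ω).untopD 0) ω) ∂M.P z)) := by
    refine tendsto_lintegral_of_dominated_convergence (fun _ => 1)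
      (fun n => (M.measurable_uncurry_transition hf hf1).comp ((hr' n).prodMk hZ0))
      (fun n => .of_forall fun ω => M.transition_le_one hf1 _ _) (by simp) (.of_forall fun ω => ?_)
    exact (M.continuousWithinAt_transition hf hf1 _ _).tendsto.comp (tendsto_nextGridPoint _)
  simp_rw [hgrid] at hL
  exact tendsto_nhds_unique hL hR

end PointMotion

/-! ### Sums of independent variables and the coupling bound -/

/-- The law of the sum of `n` independent real random variables with law `μ`. -/
noncomputable def convPower (μ : Measure ℝ) : ℕ → Measure ℝ
  | 0 => Measure.dirac 0
  | n + 1 => (convPower μ n).conv μ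

section ConvPower

variable {μ : Measure ℝ}

instance [IsProbabilityMeasure μ] (n : ℕ) : IsProbabilityMeasure (convPower μ n) := by
  induction n with
  | zero => rw [convPower]; infer_instance
  | succ n ih => rw [convPower]; infer_instance

theorem ae_nonneg_convPower (hμ : ∀ᵐ x ∂μ, 0 ≤ x) (n : ℕ) : ∀ᵐ x ∂convPower μ n, 0 ≤ x := by
  induction n with
  | zero => rw [convPower, ae_dirac_iff measurableSet_Ici]
  | succ n ih =>
    rw [convPower, Measure.conv, ae_map_iff (by fun_prop) measurableSet_Ici]
    filter_upwards [Measure.quasiMeasurePreserving_fst.ae ih,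
      Measure.quasiMeasurePreserving_snd.ae hμ] with p h1 h2 using add_nonneg h1 h2

theorem lintegral_ofReal_convPower_le [IsProbabilityMeasure μ] (n : ℕ) :
    ∫⁻ x, ENNReal.ofReal x ∂convPower μ n ≤ n * ∫⁻ x, ENNReal.ofReal x ∂μ := by
  induction n with
  | zero => simp [convPower]
  | succ n ih =>
    rw [convPower, Measure.lintegral_conv (by fun_prop)]
    calc _ ≤ ∫⁻ x, ∫⁻ y, (ENNReal.ofReal x + ENNReal.ofReal y) ∂μ ∂convPower μ n :=
          lintegral_mono fun x => lintegral_mono fun y => ENNReal.ofReal_add_le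
      _ = ∫⁻ x, ENNReal.ofReal x ∂convPower μ n + ∫⁻ y, ENNReal.ofReal y ∂μ := by
          simp_rw [lintegral_add_left measurable_const, lintegral_const, measure_univ, mul_one]
          rw [lintegral_add_right _ measurable_const, lintegral_const, measure_univ, mul_one]
      _ ≤ _ := by
          push_cast
          rw [add_mul, one_mul]
          gcongr

/-- Stochastic domination is preserved under adding an independent variable `S ≥ 0`; the left side
is `P (τ + S > t)`, split according to whether `τ ≤ t`. -/
theorem lintegral_add_measure_lt_le_conv [IsProbabilityMeasure μ] {Ω : Type*} [MeasurableSpace Ω]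
    {P : Measure Ω} [IsProbabilityMeasure P] {τ : Ω → ℝ≥0∞} (hτ : Measurable τ) {ν : Measure ℝ}
    [IsProbabilityMeasure ν] (hν : ∀ᵐ x ∂ν, 0 ≤ x)
    (hdom : ∀ s : ℝ, P {ω | (s : EReal) < (τ ω : EReal)} ≤ μ (Set.Ioi s)) (t : ℝ≥0) :
    ∫⁻ ω in {ω | τ ω ≤ t}, ν (Set.Ioi ((t - (τ ω).toNNReal : ℝ≥0) : ℝ)) ∂P +
        P {ω | τ ω ≤ t}ᶜ ≤ (ν.conv μ) (Set.Ioi (t : ℝ)) := by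
  have hle : MeasurableSet {ω | τ ω ≤ t} := measurableSet_le hτ measurable_const
  have hE : MeasurableSet {p : Ω × ℝ | ((t - p.2 : ℝ) : EReal) < (τ p.1 : EReal)} :=
    measurableSet_lt (by fun_prop) (by fun_prop)
  have hp : ∫⁻ ω, ν {x | ((t - x : ℝ) : EReal) < (τ ω : EReal)} ∂P =
      ∫⁻ x, P {ω | ((t - x : ℝ) : EReal) < (τ ω : EReal)} ∂ν := by
    have h1 := Measure.prod_apply (μ := P) (ν := ν) hE
    have h2 := Measure.prod_apply_symm (μ := P) (ν := ν) hE
    exact h1.symm.trans h2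
  have hconv : (ν.conv μ) (Set.Ioi (t : ℝ)) = ∫⁻ x, μ (Set.Ioi (t - x : ℝ)) ∂ν := by
    rw [Measure.conv, Measure.map_apply (by fun_prop) measurableSet_Ioi,
      Measure.prod_apply (measurableSet_Ioi.preimage (by fun_prop))]
    refine lintegral_congr fun x => ?_
    congr 1
    ext y
    simp [sub_lt_iff_lt_add']
  calc _ ≤ ∫⁻ ω in {ω | τ ω ≤ t}, ν {x | ((t - x : ℝ) : EReal) < (τ ω : EReal)} ∂P +
        ∫⁻ ω in {ω | τ ω ≤ t}ᶜ, ν {x | ((t - x : ℝ) : EReal) < (τ ω : EReal)} ∂P := by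
        gcongr ?_ + ?_
        · -- For `τ ≤ t` the two events coincide.
          refine setLIntegral_mono' hle fun ω hω => measure_mono fun x hx => ?_
          have hω : τ ω ≤ t := hω
          lift τ ω to ℝ≥0 using (hω.trans_lt ENNReal.coe_lt_top).ne with s
          have hst : s ≤ t := by exact_mod_cast hω
          rw [ENNReal.toNNReal_coe, Set.mem_Ioi, NNReal.coe_sub hst] at hx
          change ((t - x : ℝ) : EReal) < ((s : ℝ) : EReal)
          rw [EReal.coe_lt_coe_iff]
          linarith
        · -- For `τ > t` the event has full measure, because `ν` lives on `[0, ∞)`.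
          rw [← setLIntegral_one]
          refine setLIntegral_mono' hle.compl fun ω hω => ?_
          have hω : (t : ℝ≥0∞) < τ ω := not_le.1 hω
          rw [← measure_univ (μ := ν)]
          refine measure_mono_ae ?_
          filter_upwards [hν] with x hx _
          calc ((t - x : ℝ) : EReal) ≤ ((t : ℝ) : EReal) :=
                EReal.coe_le_coe_iff.2 (by linarith)
            _ = ((t : ℝ≥0∞) : EReal) := rfl
            _ < _ := EReal.coe_ennreal_lt_coe_ennreal_iff.2 hω
    _ = ∫⁻ x, P {ω | ((t - x : ℝ) : EReal) < (τ ω : EReal)} ∂ν := by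
        rw [lintegral_add_compl _ hle, hp]
    _ ≤ _ := by
        rw [hconv]
        exact lintegral_mono fun x => hdom _

theorem ProbabilityTheory.iIndepFun.map_sum_eq_convPower {Ω ι : Type*} [MeasurableSpace Ω]
    {P : Measure Ω} [IsProbabilityMeasure P] {ξ : ι → Ω → ℝ} (hξ : iIndepFun ξ P)
    (hm : ∀ i, AEMeasurable (ξ i) P) (hlaw : ∀ i, P.map (ξ i) = μ) (s : Finset ι) :
    P.map (fun ω => ∑ i ∈ s, ξ i ω) = convPower μ s.card := by
  classical
  induction s using Finset.induction_on with
  | empty => simp [convPower]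
  | insert i s hi ih =>
    have hind := (hξ.indepFun_finsetSum_of_notMem₀ hm hi)
    have := hind.map_add_eq_map_conv_map₀ (Finset.aemeasurable_sum s fun i _ => hm i) (hm i)
    rw [Finset.card_insert_of_notMem hi, convPower, ← ih, ← hlaw i]
    convert this using 2
    · ext ω
      simp [Finset.sum_insert hi, add_comm]
    · congr 1
      ext ω
      simp

end ConvPower

namespace PointMotion

variable {d m : ℕ} {D : Set (EuclideanSpace ℝ (Fin d))} {T : Set ℝ≥0}
  {M : PointMotion.{u} D T m}

/-- From a position where points `i` and `j` coincide, exchanging them does not change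
expectations. -/
theorem Exchangeable.transition_comp_swap (hM : M.Exchangeable) {z : Fin m → D} {i j : Fin m}
    (hij : i ≠ j) (hz : z i = z j) {f : (Fin m → D) → ℝ≥0∞} (hf : Measurable f) (t : ℝ≥0) :
    M.transition (fun y => f (y ∘ Equiv.swap i j)) t z = M.transition f t z := by
  have hft : Measurable fun w : ℝ≥0 → Fin m → D => f (w t) := hf.comp (measurable_pi_apply t)
  have hswap : Measurable fun ω (t : ℝ≥0) (l : Fin m) => M.Z z t ω (Equiv.swap i j l) :=
    measurable_pi_lambda _ fun t => measurable_pi_lambda _ fun l =>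
      (measurable_pi_apply _).comp ((M.isStrongMarkovRCLL z).measurable t)
  rw [← M.lintegral_Q hf, ← hM z i j hij hz, lintegral_map hft hswap]
  rfl

/-- A variable that dominates a meeting time is nonnegative, as meeting times are. -/
theorem ae_nonneg_of_dominated {μ : Measure ℝ} [IsProbabilityMeasure μ] {z : Fin m → D}
    {i j : Fin m}
    (hdom : ∀ s : ℝ, M.P z {ω | (s : EReal) < (meetingTime (fun t => M.Z z t ω) i j : EReal)} ≤
      μ (Set.Ioi s)) : ∀ᵐ x ∂μ, 0 ≤ x := by
  have hlt : ∀ s : ℝ, s < 0 → ∀ᵐ x ∂μ, s < x := by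
    intro s hs
    have h1 : {ω | (s : EReal) < (meetingTime (fun t => M.Z z t ω) i j : EReal)} = Set.univ :=
      Set.eq_univ_of_forall fun ω =>
        (EReal.coe_neg'.2 hs).trans_le (EReal.coe_ennreal_nonneg _)
    have h2 := hdom s
    rw [h1, measure_univ] at h2
    exact (prob_compl_eq_zero_iff measurableSet_Ioi).2 (le_antisymm prob_le_one h2)
  have hall : ∀ᵐ x ∂μ, ∀ n : ℕ, -(1 / ((n : ℝ) + 1)) < x :=
    ae_all_iff.2 fun n => hlt _ (neg_lt_zero.2 (by positivity))
  filter_upwards [hall] with x hx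
  refine le_of_tendsto' (?_ : Tendsto (fun n : ℕ => -(1 / ((n : ℝ) + 1))) atTop (𝓝 0))
    fun n => (hx n).le
  simpa using (tendsto_one_div_add_atTop_nhds_zero_nat (𝕜 := ℝ)).neg

/-- The coupling bound: if `π` moves at most `n` labels, then relabelling the positions at time `t`
by `π` changes the expectation of `f` by at most the probability that a sum of `n` independent
copies of the dominating variable exceeds `t`.

Write `π` as a transposition `σ` of `i` and `π i` times a permutation that moves fewer labels. From
the meeting time of `i` and `π i` on, `σ` can be absorbed by exchangeability, and the induction
hypothesis applies to the time that remains. -/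
theorem Exchangeable.transition_le_add (hT : IsTimeSet T) (hM : M.Exchangeable)
    {μ : Measure ℝ} [IsProbabilityMeasure μ]
    (hdom : ∀ (z : Fin m → D) (i j : Fin m), i ≠ j → ∀ s : ℝ,
      M.P z {ω | (s : EReal) < (meetingTime (fun t => M.Z z t ω) i j : EReal)} ≤ μ (Set.Ioi s))
    (n : ℕ) (π : Equiv.Perm (Fin m)) (hπ : π.support.card ≤ n) {f : (Fin m → D) → ℝ≥0∞}
    (hf : Continuous f) (hf1 : ∀ y, f y ≤ 1) (t : ℝ≥0) (z : Fin m → D) :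
    M.transition f t z ≤
      M.transition (fun y => f (y ∘ π)) t z + convPower μ n (Set.Ioi (t : ℝ)) := by
  induction n generalizing π f t z with
  | zero =>
    have : π = 1 := Equiv.Perm.support_eq_empty_iff.1 (Finset.card_eq_zero.1 (by lia))
    subst this
    exact le_self_add
  | succ n ih =>
    by_cases hπ1 : π = 1
    · subst hπ1
      exact le_self_add
    obtain ⟨i, hi⟩ : ∃ i, π i ≠ i := by
      by_contra! h
      exact hπ1 (Equiv.ext h)
    set σ := Equiv.swap i (π i) with hσ
    have hcard : (σ * π).support.card ≤ n := by
      have := Equiv.Perm.card_support_swap_mul hi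
      lia
    set g : (Fin m → D) → ℝ≥0∞ := fun y => f (y ∘ (σ * π : Equiv.Perm (Fin m))) with hg
    have hgc : Continuous g := hf.comp (continuous_pi fun l => continuous_apply _)
    have hg1 : ∀ y, g y ≤ 1 := fun y => hf1 _
    have hgσ : ∀ y, g (y ∘ σ) = f (y ∘ π) := by
      intro y
      simp only [hg]
      congr 1
      ext1 l
      simp [hσ]
    have hgσc : Continuous fun y => g (y ∘ σ) :=
      hgc.comp (continuous_pi fun l => continuous_apply _)
    have h := M.isStrongMarkovRCLL z
    set τ : M.Ω z → ℝ≥0∞ := fun ω => meetingTime (fun s => M.Z z s ω) i (π i)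
    have hτm : Measurable τ := h.measurable_meetingTime _ _
    have hτ : IsStoppingTime (M.ℱ z) (τ : M.Ω z → WithTop ℝ≥0) := h.isStoppingTime_meetingTime _ _
    have hτT : ∀ ω (s : ℝ≥0), τ ω = s → s ∈ T := fun ω s hs =>
      h.mem_of_meetingTime_eq hT _ _ ω s hs
    have hle : MeasurableSet {ω | τ ω ≤ t} := measurableSet_le hτm measurable_const
    have hsm : ∀ {f : (Fin m → D) → ℝ≥0∞}, Continuous f → (∀ y, f y ≤ 1) →
        ∫⁻ ω in {ω | τ ω ≤ t}, f (M.Z z t ω) ∂M.P z = ∫⁻ ω in {ω | τ ω ≤ t},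
          M.transition f (t - (τ ω).toNNReal) (M.Z z (τ ω).toNNReal ω) ∂M.P z :=
      fun hf hf1 => M.setLIntegral_le_eq_transition z hτ hτT t hf hf1
    have hmeas : Measurable fun ω =>
        M.transition g (t - (τ ω).toNNReal) (M.Z z (τ ω).toNNReal ω) :=
      (M.measurable_uncurry_transition hgc hg1).comp
        ((hτm.ennreal_toNNReal.const_sub t).prodMk
          (h.measurable_uncurry.comp (hτm.ennreal_toNNReal.prodMk measurable_id)))
    calc M.transition f t z
        = ∫⁻ ω in {ω | τ ω ≤ t}, f (M.Z z t ω) ∂M.P z +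
          ∫⁻ ω in {ω | τ ω ≤ t}ᶜ, f (M.Z z t ω) ∂M.P z := (lintegral_add_compl _ hle).symm
      _ ≤ ∫⁻ ω in {ω | τ ω ≤ t},
            (M.transition g (t - (τ ω).toNNReal) (M.Z z (τ ω).toNNReal ω) +
              convPower μ n (Set.Ioi ((t - (τ ω).toNNReal : ℝ≥0) : ℝ))) ∂M.P z +
          M.P z {ω | τ ω ≤ t}ᶜ := by
          rw [hsm hf hf1]
          gcongr ?_ + ?_
          · exact lintegral_mono fun ω => ih (σ * π) hcard hf hf1 _ _
          · rw [← setLIntegral_one]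
            exact lintegral_mono fun ω => hf1 _
      _ = ∫⁻ ω in {ω | τ ω ≤ t},
            M.transition g (t - (τ ω).toNNReal) (M.Z z (τ ω).toNNReal ω) ∂M.P z +
          (∫⁻ ω in {ω | τ ω ≤ t},
              convPower μ n (Set.Ioi ((t - (τ ω).toNNReal : ℝ≥0) : ℝ)) ∂M.P z +
            M.P z {ω | τ ω ≤ t}ᶜ) := by
          rw [lintegral_add_left hmeas, add_assoc]
      _ = ∫⁻ ω in {ω | τ ω ≤ t}, f (M.Z z t ω ∘ π) ∂M.P z +
          (∫⁻ ω in {ω | τ ω ≤ t},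
              convPower μ n (Set.Ioi ((t - (τ ω).toNNReal : ℝ≥0) : ℝ)) ∂M.P z +
            M.P z {ω | τ ω ≤ t}ᶜ) := by
          congr 1
          simp_rw [← hgσ]
          rw [hsm hgσc fun y => hg1 _]
          refine setLIntegral_congr_fun hle fun ω hω => ?_
          have hω : τ ω ≤ t := hω
          refine (hM.transition_comp_swap (Ne.symm hi) ?_ hgc.measurable _).symm
          exact apply_eq_of_meetingTime_eq (h.continuousWithinAt ω)
            (ENNReal.coe_toNNReal (hω.trans_lt ENNReal.coe_lt_top).ne).symm
      _ ≤ _ := by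
          gcongr ?_ + ?_
          · exact setLIntegral_le_lintegral _ _
          · have hdom' := hdom z i (π i) (Ne.symm hi)
            exact lintegral_add_measure_lt_le_conv hτm
              (ae_nonneg_convPower (ae_nonneg_of_dominated hdom') n) hdom' t

end PointMotion

/-! ### Rank-to-index permutations and mixing -/

/-- A one-sided bound for continuous test functions extends to measurable sets. -/
theorem measure_le_add_of_forall_continuous {S : Type*} [TopologicalSpace S]
    [TopologicalSpace.PseudoMetrizableSpace S] [MeasurableSpace S] [BorelSpace S]
    {ν₁ ν₂ : Measure S} [IsFiniteMeasure ν₁] [IsFiniteMeasure ν₂] {c : ℝ≥0∞}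
    (h : ∀ f : S → ℝ≥0∞, Continuous f → (∀ y, f y ≤ 1) →
      ∫⁻ y, f y ∂ν₁ ≤ ∫⁻ y, f y ∂ν₂ + c) {B : Set S} (hB : MeasurableSet B) :
    ν₁ B ≤ ν₂ B + c := by
  have hclosed : ∀ F : Set S, IsClosed F → ν₁ F ≤ ν₂ F + c := by
    intro F hF
    refine le_of_tendsto_of_tendsto' (HasOuterApproxClosed.tendsto_lintegral_apprSeq hF ν₁)
      ((HasOuterApproxClosed.tendsto_lintegral_apprSeq hF ν₂).add_const c) fun n => ?_
    exact h _ (ENNReal.continuous_coe.comp (hF.apprSeq n).continuous)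
      fun y => by exact_mod_cast HasOuterApproxClosed.apprSeq_apply_le_one hF n y
  refine ENNReal.le_of_forall_pos_le_add fun ε hε _ => ?_
  obtain ⟨F, hFB, hF, hlt⟩ := hB.exists_isClosed_lt_add (measure_ne_top ν₁ B)
    (ENNReal.coe_pos.2 hε).ne'
  calc ν₁ B ≤ ν₁ F + ε := hlt.le
    _ ≤ ν₂ F + c + ε := by gcongr; exact hclosed F hF
    _ ≤ _ := by gcongr

section Rank

variable {m : ℕ}

/-- Distinct marks exclude ties, so that relabelling the points by `π` turns `γ` into `π⁻¹ * γ`.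
With ties in both coordinates `Tuple.sort` would break them by the index. -/
theorem rankToIndex_comp {x u : Fin m → ℝ} (hu : Function.Injective u) (π : Equiv.Perm (Fin m)) :
    rankToIndex (x ∘ π) (u ∘ π) = π⁻¹ * rankToIndex x u := by
  set g : Fin m → ℝ ×ₗ ℝ := fun j => toLex (x j, u j) with hg
  have hinj : Function.Injective g := fun a b hab => hu (congrArg (fun p => (ofLex p).2) hab)
  have h := Tuple.comp_perm_comp_sort_eq_comp_sort (f := g) (σ := π)
  have h' : rankToIndex (x ∘ π) (u ∘ π) = Tuple.sort (g ∘ π) := rfl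
  rw [eq_inv_mul_iff_mul_eq, h']
  ext1 l
  exact hinj (congrFun h l)

theorem measurableSet_rankToIndex_eq (σ : Equiv.Perm (Fin m)) :
    MeasurableSet {p : (Fin m → ℝ) × (Fin m → ℝ) | rankToIndex p.1 p.2 = σ} := by
  have heq : {p : (Fin m → ℝ) × (Fin m → ℝ) | rankToIndex p.1 p.2 = σ} =
      {p | (∀ i j, i ≤ j → p.1 (σ i) < p.1 (σ j) ∨
          p.1 (σ i) = p.1 (σ j) ∧ p.2 (σ i) ≤ p.2 (σ j)) ∧
        ∀ i j, i < j → p.1 (σ i) = p.1 (σ j) ∧ p.2 (σ i) = p.2 (σ j) → σ i < σ j} := by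
    ext p
    rw [Set.mem_ofPred_eq, Set.mem_ofPred_eq, eq_comm, rankToIndex, Tuple.eq_sort_iff]
    simp only [Monotone, Function.comp_apply, Prod.Lex.toLex_le_toLex,
      EmbeddingLike.apply_eq_iff_eq, Prod.mk.injEq]
  rw [heq]
  have h1 : ∀ i : Fin m, Measurable fun p : (Fin m → ℝ) × (Fin m → ℝ) => p.1 i :=
    fun i => (measurable_pi_apply i).comp measurable_fst
  have h2 : ∀ i : Fin m, Measurable fun p : (Fin m → ℝ) × (Fin m → ℝ) => p.2 i :=
    fun i => (measurable_pi_apply i).comp measurable_snd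
  refine measurableSet_setOfPred.2 (.and (.forall fun i => .forall fun j => .forall fun _ => ?_)
    (.forall fun i => .forall fun j => .forall fun _ => .imp ?_ measurable_const))
  · exact measurableSet_setOfPred.1 ((measurableSet_lt (h1 _) (h1 _)).union
      ((measurableSet_eq_fun (h1 _) (h1 _)).inter (measurableSet_le (h2 _) (h2 _))))
  · exact measurableSet_setOfPred.1
      ((measurableSet_eq_fun (h1 _) (h1 _)).inter (measurableSet_eq_fun (h2 _) (h2 _)))

instance : IsProbabilityMeasure ((volume : Measure ℝ).restrict (Set.Icc 0 1)) :=
  ⟨by simp⟩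

instance : IsProbabilityMeasure (uniformMarks m) := by
  unfold uniformMarks; infer_instance

theorem ae_injective_uniformMarks : ∀ᵐ u ∂uniformMarks m, Function.Injective u := by
  have habs : uniformMarks m ≪ volume := by
    rw [uniformMarks, ← Measure.restrict_pi_pi]
    exact Measure.absolutelyContinuous_of_le Measure.restrict_le_self
  have hne : ∀ i j : Fin m, i ≠ j → ∀ᵐ u ∂uniformMarks m, u i ≠ u j := by
    intro i j hij
    -- The coincidence set is a proper subspace, hence Lebesgue-null.
    let L : Submodule ℝ (Fin m → ℝ) :=
      LinearMap.ker (LinearMap.proj (R := ℝ) (φ := fun _ : Fin m => ℝ) i - LinearMap.proj j)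
    have hL : L ≠ ⊤ := by
      intro h
      have h1 : Pi.single i (1 : ℝ) ∈ L := h ▸ Submodule.mem_top
      simp [L, hij.symm] at h1
    refine measure_mono_null (fun u hu => ?_) (habs (Measure.addHaar_submodule volume L hL))
    have hu : ¬ (u i ≠ u j) := hu
    simpa [L, sub_eq_zero] using hu
  have hall : ∀ᵐ u ∂uniformMarks m, ∀ i j, i ≠ j → u i ≠ u j :=
    ae_all_iff.2 fun i => ae_all_iff.2 fun j => by
      by_cases hij : i = j
      · simp [hij]
      · simpa [hij] using hne i j hij
  filter_upwards [hall] with u hu i j huij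
  exact not_imp_not.1 (hu i j) huij

theorem map_comp_perm_uniformMarks (π : Equiv.Perm (Fin m)) :
    (uniformMarks m).map (fun u => u ∘ π) = uniformMarks m := by
  have hm : Measurable fun u : Fin m → ℝ => u ∘ π :=
    measurable_pi_lambda _ fun i => measurable_pi_apply _
  refine (Measure.pi_eq fun s hs => ?_).symm
  rw [Measure.map_apply hm (MeasurableSet.univ_pi hs)]
  have : (fun u : Fin m → ℝ => u ∘ π) ⁻¹' Set.univ.pi s = Set.univ.pi fun i => s (π.symm i) := by
    ext u
    simp only [Set.mem_preimage, Set.mem_univ_pi, Function.comp_apply]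
    exact ⟨fun h i => by simpa using h (π.symm i), fun h i => by simpa using h (π i)⟩
  rw [this, uniformMarks, Measure.pi_pi]
  exact Equiv.prod_comp π.symm fun i => (volume.restrict (Set.Icc (0 : ℝ) 1)) (s i)

end Rank

namespace PointMotion

variable {d m : ℕ} {D : Set (EuclideanSpace ℝ (Fin d))} {T : Set ℝ≥0}

section RankProb

variable (M : PointMotion.{u} D T m) (k : Fin d) (z : Fin m → D) (t : ℝ≥0)

/-- The rank-to-index permutation as a function of the outcome and the marks. -/
noncomputable def rank (p : M.Ω z × (Fin m → ℝ)) : Equiv.Perm (Fin m) :=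
  rankToIndex (fun i => (M.Z z t p.1 i : EuclideanSpace ℝ (Fin d)) k) p.2

theorem measurable_coord : Measurable fun y : Fin m → D => fun i =>
    (y i : EuclideanSpace ℝ (Fin d)) k :=
  measurable_pi_lambda _ fun i => by fun_prop

theorem measurableSet_rank_mem (A : Finset (Equiv.Perm (Fin m))) :
    MeasurableSet {p | M.rank k z t p ∈ A} := by
  have h1 : Measurable fun p : M.Ω z × (Fin m → ℝ) =>
      (fun i => (M.Z z t p.1 i : EuclideanSpace ℝ (Fin d)) k, p.2) :=
    ((measurable_coord k).comp
      (((M.isStrongMarkovRCLL z).measurable t).comp measurable_fst)).prodMk measurable_snd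
  have : {p | M.rank k z t p ∈ A} = ⋃ σ ∈ A, {p | M.rank k z t p = σ} := by
    ext p; simp
  rw [this]
  exact Finset.measurableSet_biUnion A fun σ _ => h1 (measurableSet_rankToIndex_eq σ)

theorem rankProb_eq_sum (A : Finset (Equiv.Perm (Fin m))) :
    M.rankProb k z t A = ∑ σ ∈ A, M.rankProb k z t {σ} := by
  have : {p | M.rank k z t p ∈ A} = ⋃ σ ∈ A, {p | M.rank k z t p ∈ ({σ} : Finset _)} := by
    ext p; simp
  change ((M.P z).prod (uniformMarks m)).real {p | M.rank k z t p ∈ A} = _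
  rw [this, measureReal_biUnion_finset]
  · rfl
  · intro σ _ σ' _ hne
    refine Set.disjoint_left.2 fun p h1 h2 => hne ?_
    exact (Finset.mem_singleton.1 h1).symm.trans (Finset.mem_singleton.1 h2)
  · exact fun σ _ => M.measurableSet_rank_mem k z t _

theorem rankProb_univ : M.rankProb k z t Finset.univ = 1 := by
  simp [rankProb]

theorem rankProb_compl (A : Finset (Equiv.Perm (Fin m))) :
    M.rankProb k z t Aᶜ = 1 - M.rankProb k z t A := by
  rw [← M.rankProb_univ k z t, M.rankProb_eq_sum k z t Finset.univ, M.rankProb_eq_sum k z t A,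
    M.rankProb_eq_sum k z t Aᶜ, ← Finset.sum_add_sum_compl A]
  ring

/-- Averaged over all permutations `π`, the law of `π⁻¹ * γ(t)` is uniform. -/
theorem sum_rankProb_map_mulLeft (A : Finset (Equiv.Perm (Fin m))) :
    ∑ π, M.rankProb k z t (A.map (Equiv.mulLeft π).toEmbedding) = A.card := by
  simp_rw [M.rankProb_eq_sum k z t (A.map _), Finset.sum_map]
  rw [Finset.sum_comm]
  have : ∀ a ∈ A, ∑ π, M.rankProb k z t {(Equiv.mulLeft π).toEmbedding a} = 1 := by
    intro a _
    rw [← M.rankProb_univ k z t, M.rankProb_eq_sum k z t Finset.univ]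
    exact Equiv.sum_comp (Equiv.mulRight a) fun σ => M.rankProb k z t {σ}
  rw [Finset.sum_congr rfl this]
  simp

end RankProb

variable {M : PointMotion.{u} D T m}

/-- The coupling bound for the rank-to-index permutation: the laws of `γ(t)` and of `π⁻¹ * γ(t)` are
close. The marks are permuted along with the points, which preserves their law. -/
theorem Exchangeable.rankProb_le_add (hT : IsTimeSet T) (hM : M.Exchangeable)
    {μ : Measure ℝ} [IsProbabilityMeasure μ]
    (hdom : ∀ (z : Fin m → D) (i j : Fin m), i ≠ j → ∀ s : ℝ,
      M.P z {ω | (s : EReal) < (meetingTime (fun t => M.Z z t ω) i j : EReal)} ≤ μ (Set.Ioi s))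
    (π : Equiv.Perm (Fin m)) (k : Fin d) (z : Fin m → D) (t : ℝ≥0)
    (A : Finset (Equiv.Perm (Fin m))) :
    M.rankProb k z t A ≤ M.rankProb k z t (A.map (Equiv.mulLeft π).toEmbedding) +
      (convPower μ m).real (Set.Ioi (t : ℝ)) := by
  set c := convPower μ m (Set.Ioi (t : ℝ))
  have hZ := (M.isStrongMarkovRCLL z).measurable t
  have hperm : Measurable fun y : Fin m → D => y ∘ π :=
    measurable_pi_lambda _ fun i => measurable_pi_apply _
  have hZπ : Measurable fun ω => M.Z z t ω ∘ π := hperm.comp hZ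
  have hlaw : ∀ B : Set (Fin m → D), MeasurableSet B →
      M.P z {ω | M.Z z t ω ∈ B} ≤ M.P z {ω | M.Z z t ω ∘ π ∈ B} + c := by
    intro B hB
    have h := measure_le_add_of_forall_continuous (ν₁ := (M.P z).map (M.Z z t))
      (ν₂ := (M.P z).map fun ω => M.Z z t ω ∘ π) (c := c) (fun f hf hf1 => ?_) hB
    · rwa [Measure.map_apply hZ hB, Measure.map_apply hZπ hB] at h
    · rw [lintegral_map hf.measurable hZ, lintegral_map hf.measurable hZπ]
      exact hM.transition_le_add hT hdom m π (by simpa using Finset.card_le_univ π.support)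
        hf hf1 t z
  set E : Set ((Fin m → D) × (Fin m → ℝ)) :=
    {q | rankToIndex (fun i => (q.1 i : EuclideanSpace ℝ (Fin d)) k) q.2 ∈ A} with hE
  have hEm : MeasurableSet E := by
    have : E = ⋃ σ ∈ A,
        {q | rankToIndex (fun i => (q.1 i : EuclideanSpace ℝ (Fin d)) k) q.2 = σ} := by
      ext q; simp [hE]
    rw [this]
    exact Finset.measurableSet_biUnion A fun σ _ => ((measurable_coord k).comp
      measurable_fst).prodMk measurable_snd (measurableSet_rankToIndex_eq σ)
  have hF : Measurable fun p : M.Ω z × (Fin m → ℝ) => (M.Z z t p.1, p.2) :=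
    (hZ.comp measurable_fst).prodMk measurable_snd
  have hFπ : Measurable fun p : M.Ω z × (Fin m → ℝ) => (M.Z z t p.1 ∘ π, p.2) :=
    (hperm.comp (hZ.comp measurable_fst)).prodMk measurable_snd
  have hmarks : MeasurePreserving (Prod.map id fun u : Fin m → ℝ => u ∘ π)
      ((M.P z).prod (uniformMarks m)) ((M.P z).prod (uniformMarks m)) :=
    (MeasurePreserving.id _).prod
      ⟨measurable_pi_lambda _ fun i => measurable_pi_apply _, map_comp_perm_uniformMarks π⟩
  have hae : ∀ᵐ p ∂(M.P z).prod (uniformMarks m),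
      p ∈ {p : M.Ω z × (Fin m → ℝ) | (M.Z z t p.1 ∘ π, p.2 ∘ π) ∈ E} ↔
        p ∈ {p | M.rank k z t p ∈ A.map (Equiv.mulLeft π).toEmbedding} := by
    filter_upwards [Measure.quasiMeasurePreserving_snd.ae ae_injective_uniformMarks] with p hp
    have hr : rankToIndex (fun i => ((M.Z z t p.1 ∘ π) i : EuclideanSpace ℝ (Fin d)) k)
        (p.2 ∘ π) = π⁻¹ * M.rank k z t p :=
      rankToIndex_comp (x := fun i => (M.Z z t p.1 i : EuclideanSpace ℝ (Fin d)) k) hp π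
    simp only [hE, Set.mem_ofPred_eq]
    rw [hr, Finset.mem_map_equiv, Equiv.mulLeft_symm, Equiv.coe_mulLeft]
  have hmain : ((M.P z).prod (uniformMarks m)) {p | M.rank k z t p ∈ A} ≤
      ((M.P z).prod (uniformMarks m))
        {p | M.rank k z t p ∈ A.map (Equiv.mulLeft π).toEmbedding} + c := by
    calc _ = ∫⁻ u, M.P z {ω | M.Z z t ω ∈ {y | (y, u) ∈ E}} ∂uniformMarks m :=
          Measure.prod_apply_symm (hF hEm)
      _ ≤ ∫⁻ u, (M.P z {ω | M.Z z t ω ∘ π ∈ {y | (y, u) ∈ E}} + c) ∂uniformMarks m :=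
          lintegral_mono fun u => hlaw _ (measurable_prodMk_right hEm)
      _ = ((M.P z).prod (uniformMarks m)) {p | (M.Z z t p.1 ∘ π, p.2) ∈ E} + c := by
          rw [lintegral_add_right _ measurable_const, lintegral_const, measure_univ, mul_one]
          congr 1
          exact (Measure.prod_apply_symm (hFπ hEm)).symm
      _ = ((M.P z).prod (uniformMarks m)) {p | (M.Z z t p.1 ∘ π, p.2 ∘ π) ∈ E} + c := by
          congr 1
          exact (hmarks.measure_preimage (hFπ hEm).nullMeasurableSet).symm
      _ = _ := by rw [measure_congr (Filter.eventuallyEq_set.2 hae)]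
  have := ENNReal.toReal_mono (by finiteness) hmain
  rwa [ENNReal.toReal_add (by finiteness) (by finiteness)] at this

theorem Exchangeable.tvUniform_le (hT : IsTimeSet T) (hM : M.Exchangeable)
    {μ : Measure ℝ} [IsProbabilityMeasure μ]
    (hdom : ∀ (z : Fin m → D) (i j : Fin m), i ≠ j → ∀ s : ℝ,
      M.P z {ω | (s : EReal) < (meetingTime (fun t => M.Z z t ω) i j : EReal)} ≤ μ (Set.Ioi s))
    (k : Fin d) (z : Fin m → D) (t : ℝ≥0) :
    M.tvUniform k z t ≤ (convPower μ m).real (Set.Ioi (t : ℝ)) := by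
  set c := (convPower μ m).real (Set.Ioi (t : ℝ))
  have hfac : (0 : ℝ) < m.factorial := by exact_mod_cast m.factorial_pos
  have hcard : ((Finset.univ : Finset (Equiv.Perm (Fin m))).card : ℝ) = m.factorial := by
    rw [Finset.card_univ, Fintype.card_perm, Fintype.card_fin]
  have hupper : ∀ A : Finset (Equiv.Perm (Fin m)),
      M.rankProb k z t A ≤ A.card / m.factorial + c := by
    intro A
    have hsum := Finset.sum_le_sum fun π (_ : π ∈ Finset.univ) =>
      hM.rankProb_le_add hT hdom π k z t A
    rw [Finset.sum_add_distrib, M.sum_rankProb_map_mulLeft k z t A, Finset.sum_const,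
      Finset.sum_const, nsmul_eq_mul, nsmul_eq_mul, hcard] at hsum
    rw [div_add' _ _ _ hfac.ne', le_div_iff₀ hfac]
    linarith
  refine ciSup_le fun A => abs_sub_le_iff.2 ⟨by linarith [hupper A], ?_⟩
  have h1 := hupper Aᶜ
  have h2 : ((Aᶜ.card : ℕ) : ℝ) = m.factorial - A.card := by
    rw [← hcard, Finset.card_univ, ← Finset.card_add_card_compl A]
    push_cast
    ring
  rw [M.rankProb_compl k z t A, h2, sub_div, div_self hfac.ne'] at h1
  linarith

end PointMotion

theorem theorem6 {d : ℕ} (D : Set (EuclideanSpace ℝ (Fin d))) (hD : MeasurableSet D)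
    (T : Set ℝ≥0) (hT : IsTimeSet T) (k : Fin d)
    (M : ∀ m : ℕ, PointMotion.{u} D T m)
    (hexch : ∀ m, (M m).Exchangeable)
    {Ω₁ : Type*} [MeasurableSpace Ω₁] (P₁ : Measure Ω₁) [IsProbabilityMeasure P₁]
    (ζ : Ω₁ → ℝ) (hζ : AEMeasurable ζ P₁)
    (hdom : ∀ (m : ℕ) (z : Fin m → D) (i j : Fin m), i ≠ j →
      StochDominated ((M m).P z) (fun ω => meetingTime (fun t => (M m).Z z t ω) i j) P₁ ζ) :
    (∀ (m : ℕ) {Ω₂ : Type*} [MeasurableSpace Ω₂] (P₂ : Measure Ω₂) [IsProbabilityMeasure P₂]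
        (ξ : Fin m → Ω₂ → ℝ), iIndepFun ξ P₂ → (∀ i, IdentDistrib (ξ i) ζ P₂ P₁) →
        ∀ (z : Fin m → D) (t : ℝ≥0),
          (M m).tvUniform k z t ≤ P₂.real {ω | (t : ℝ) < ∑ i, ξ i ω}) ∧
      (Integrable ζ P₁ → ∀ ε : ℝ, 0 < ε → ∃ C : ℝ≥0, ∀ m : ℕ,
        (M m).mixingTime k ε ≤ (C : ℝ≥0∞) * (m : ℝ≥0∞)) := by
  set μ := P₁.map ζ with hμ
  have : IsProbabilityMeasure μ := Measure.isProbabilityMeasure_map hζ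
  have hdom' : ∀ (m : ℕ) (z : Fin m → D) (i j : Fin m), i ≠ j → ∀ s : ℝ,
      (M m).P z {ω | (s : EReal) < (meetingTime (fun t => (M m).Z z t ω) i j : EReal)} ≤
        μ (Set.Ioi s) := by
    intro m z i j hij s
    rw [hμ, Measure.map_apply_of_aemeasurable hζ measurableSet_Ioi]
    exact hdom m z i j hij s
  have htv : ∀ m (z : Fin m → D) (t : ℝ≥0),
      (M m).tvUniform k z t ≤ (convPower μ m).real (Set.Ioi (t : ℝ)) := fun m z t =>
    (hexch m).tvUniform_le hT (hdom' m) k z t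
  refine ⟨fun m Ω₂ _ P₂ _ ξ hind hid z t => ?_, fun hint ε hε => ?_⟩
  · have hm : ∀ i, AEMeasurable (ξ i) P₂ := fun i => (hid i).aemeasurable_fst
    have hsum := hind.map_sum_eq_convPower hm (fun i => (hid i).map_eq) Finset.univ
    rw [Finset.card_univ, Fintype.card_fin] at hsum
    refine (htv m z t).trans_eq ?_
    rw [← hsum, map_measureReal_apply_of_aemeasurable
      (Finset.aemeasurable_fun_sum _ fun i _ => hm i) measurableSet_Ioi]
    rfl
  · set I := ∫⁻ x, ENNReal.ofReal x ∂μ with hI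
    have hIfin : I ≠ ∞ := by
      rw [hI, hμ, lintegral_map' (by fun_prop) hζ]
      exact (hint.lintegral_lt_top).ne
    -- The summand `1` makes the inequality `I / C < ε` strict, also when `I = 0`.
    refine ⟨I.toNNReal / ε.toNNReal + 1, fun m => ?_⟩
    set C := I.toNNReal / ε.toNNReal + 1 with hC
    have hε' : 0 < ε.toNNReal := Real.toNNReal_pos.2 hε
    rw [show (C : ℝ≥0∞) * m = ((C * m : ℝ≥0) : ℝ≥0∞) by push_cast; rfl]
    refine iInf₂_le (f := fun (t : ℝ≥0) (_ : ∀ z, (M m).tvUniform k z t < ε) => (t : ℝ≥0∞))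
      (C * m) fun z => ((htv m z _).trans_lt ?_)
    rcases m.eq_zero_or_pos with rfl | hmpos
    · simpa [convPower, Measure.real] using hε
    -- Markov's inequality for the sum of `m` copies at time `C * m`.
    have hmark : (C * m : ℝ≥0) * convPower μ m (Set.Ioi ((C * m : ℝ≥0) : ℝ)) ≤ m * I := by
      refine le_trans ?_ (lintegral_ofReal_convPower_le m)
      refine le_trans (mul_le_mul_right (measure_mono fun x hx => ?_) _)
        (mul_meas_ge_le_lintegral (by fun_prop) _)
      rw [Set.mem_ofPred_eq, ← ENNReal.ofReal_coe_nnreal]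
      exact ENNReal.ofReal_le_ofReal (le_of_lt hx)
    have hfin : m * I ≠ ∞ := ENNReal.mul_ne_top (ENNReal.natCast_ne_top m) hIfin
    have hreal := ENNReal.toReal_mono hfin hmark
    rw [ENNReal.toReal_mul, ENNReal.toReal_mul, ENNReal.coe_toReal, ENNReal.toReal_natCast] at hreal
    change _ * (convPower μ m).real _ ≤ _ at hreal
    have hmpos' : (0 : ℝ) < m := by exact_mod_cast hmpos
    have hIε : I.toReal < ε * C := by
      have : (C : ℝ) = I.toReal / ε + 1 := by
        rw [hC]; push_cast; rw [Real.coe_toNNReal ε hε.le]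
      rw [this, mul_add, mul_div_cancel₀ _ hε.ne']
      linarith
    have hCpos : (0 : ℝ) < C := by
      have : 0 < C := by positivity
      exact_mod_cast this
    refine lt_of_mul_lt_mul_left (a := ((C * m : ℝ≥0) : ℝ)) (hreal.trans_lt ?_) (by positivity)
    push_cast
    nlinarith
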